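/- **Syntax.** Formulae are built from constants $\top,\bot$, countably infinitely many object variables $p$ and property variables $P$ by binary $\sqcup,\sqcap$ and unary $\neg,\lrcorner,\square,\blacksquare$. Put $\alpha\vee\beta:=\neg(\neg\alpha\sqcap\neg\beta)$, $\alpha\wedge\beta:=\lrcorner(\lrcorner\alpha\sqcup\lrcorner\beta)$, $\lozenge\alpha:=\neg\square\neg\alpha$, $\blacklozenge\alpha:=\lrcorner\blacksquare\lrcorner\alpha$. A sequent is a pair $\alpha\vdash\beta$ of formulae; an s-hypersequent is a finite (possibly empty) sequence $\alpha_1\vdash\beta_1\mid\dots\mid\alpha_n\vdash\beta_n$ of sequents. $\alpha\dashv\vdash\beta$ stands for both $\alpha\vdash\beta$ and $\beta\vdash\alpha$. **The logic MPDBL5.** Its axioms are all instances of: $\alpha\vdash\alpha$; $\alpha\sqcap\beta\vdash\alpha$; $\alpha\vdash\alpha\sqcup\beta$; $\alpha\sqcap\beta\vdash\beta$; $\beta\vdash\alpha\sqcup\beta$; $\alpha\sqcap\beta\vdash(\alpha\sqcap\beta)\sqcap(\alpha\sqcap\beta)$; $(\alpha\sqcup\beta)\sqcup(\alpha\sqcup\beta)\vdash\alpha\sqcup\beta$;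 $\neg(\alpha\sqcap\alpha)\vdash\neg\alpha$; $\lrcorner\alpha\vdash\lrcorner(\alpha\sqcup\alpha)$; $\alpha\sqcap\neg\alpha\vdash\bot$; $\top\vdash\alpha\sqcup\lrcorner\alpha$; $\neg\neg(\alpha\sqcap\beta)\dashv\vdash\alpha\sqcap\beta$; $\lrcorner\lrcorner(\alpha\sqcup\beta)\dashv\vdash\alpha\sqcup\beta$; $\alpha\sqcap\alpha\vdash\alpha\sqcap(\alpha\sqcup\beta)$; $\alpha\sqcup(\alpha\sqcap\beta)\vdash\alpha\sqcup\alpha$; $\alpha\sqcap\alpha\vdash\alpha\sqcap(\alpha\vee\beta)$; $\alpha\sqcup(\alpha\wedge\beta)\vdash\alpha\sqcup\alpha$; $\alpha\sqcap(\beta\vee\gamma)\dashv\vdash(\alpha\sqcap\beta)\vee(\alpha\sqcap\gamma)$; $\alpha\sqcup(\beta\wedge\gamma)\dashv\vdash(\alpha\sqcup\beta)\wedge(\alpha\sqcup\gamma)$; $\bot\vdash\alpha$; $\alpha\vdash\top$; $\neg\top\vdash\bot$; $\top\vdash\lrcorner\bot$; $\neg\bot\dashv\vdash\top\sqcap\top$;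 $\lrcorner\top\dashv\vdash\bot\sqcup\bot$; $(\alpha\sqcup\alpha)\sqcap(\alpha\sqcup\alpha)\dashv\vdash(\alpha\sqcap\alpha)\sqcup(\alpha\sqcap\alpha)$; $p\sqcap p\dashv\vdash p$ for object variables $p$; $P\sqcup P\dashv\vdash P$ for property variables $P$; $\square\alpha\sqcap\square\beta\dashv\vdash\square(\alpha\sqcap\beta)$; $\blacksquare\alpha\sqcup\blacksquare\beta\dashv\vdash\blacksquare(\alpha\sqcup\beta)$; $\square\neg\bot\dashv\vdash\neg\bot$; $\blacksquare\lrcorner\top\dashv\vdash\lrcorner\top$; $\square(\alpha\sqcap\alpha)\dashv\vdash\square\alpha$; $\blacksquare(\alpha\sqcup\alpha)\dashv\vdash\blacksquare\alpha$ (these are the axioms of MPDBL); $\square\alpha\vdash\alpha$; $\alpha\vdash\blacksquare\alpha$; $\square\square\alpha\dashv\vdash\square\alpha$; $\blacksquare\blacksquare\alpha\dashv\vdash\blacksquare\alpha$ (added in MPDBL4); and $\lozenge\alpha\vdash\square\lozenge\alpha$; $\blacksquare\blacklozenge\alpha\vdash\blacklozenge\alpha$ (added in MPDBL5). Its rules are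 as follows, where $B,C,D,E,F,G,H,X$ are possibly empty s-hypersequents. From $B\mid\alpha\vdash\beta\mid C$ infer $B\mid s\mid C$, where $s$ is any of $\alpha\sqcap\gamma\vdash\beta\sqcap\gamma$, $\gamma\sqcap\alpha\vdash\gamma\sqcap\beta$, $\alpha\sqcup\gamma\vdash\beta\sqcup\gamma$, $\gamma\sqcup\alpha\vdash\gamma\sqcup\beta$, $\neg\beta\vdash\neg\alpha$, $\lrcorner\beta\vdash\lrcorner\alpha$, $\square\alpha\vdash\square\beta$, $\blacksquare\alpha\vdash\blacksquare\beta$. From $B\mid\alpha\vdash\beta\mid C$ and $D\mid\beta\vdash\gamma\mid E$ infer $B\mid D\mid\alpha\vdash\gamma\mid C\mid E$. Without premises, infer $\alpha\vdash\alpha\sqcap\alpha\mid\alpha\sqcup\alpha\vdash\alpha$. From $B\mid\alpha\sqcap\beta\vdash\alpha\sqcap\alpha\mid C$, $D\mid\alpha\sqcap\alpha\vdash\alpha\sqcap\beta\mid E$, $F\mid\alpha\sqcup\beta\vdash\beta\sqcup\beta\mid G$ and $H\mid\beta\sqcup\beta\vdash\alpha\sqcup\beta\mid X$ infer $B\mid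 D\mid F\mid H\mid\alpha\vdash\beta\mid C\mid E\mid G\mid X$. From $B\mid D\mid D\mid C$ infer $B\mid D\mid C$; from $B\mid D\mid E\mid C$ infer $B\mid E\mid D\mid C$; from $B$ infer $B\mid C$. **Semantics.** A Kripke context is $((G,R),(M,S),I)$ with sets $G,M$ and relations $R\subseteq G\times G$, $S\subseteq M\times M$, $I\subseteq G\times M$. For $A\subseteq G$, $B\subseteq M$ put $A'=\{m\in M:\forall g\in A,\ gIm\}$ and $B'=\{g\in G:\forall m\in B,\ gIm\}$. A semiconcept is a pair $(A,B)$ with $A'=B$ or $B'=A$. A model based on the Kripke context assigns to each object variable a semiconcept $(A,B)$ with $B=A'$ and to each property variable a semiconcept $(A,B)$ with $A=B'$. Each formula $\alpha$ is interpreted as a pair $(v_1(\alpha),v_2(\alpha))$ of sets (of the $g\in G$ satisfying and of the $m\in M$ co-satisfying $\alpha$): for variables it is the assigned semiconcept, for $\top$ it is $(G,\emptyset)$, for $\bot$ it is $(\emptyset,M)$, and - $v_1(\alpha\sqcap\beta)=v_1(\alpha)\cap v_1(\beta)$, $v_1(\neg\alpha)=G\setminus v_1(\alpha)$, $v_1(\square\alpha)=\{g:\forall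 g_1\,(gRg_1\Rightarrow g_1\in v_1(\alpha))\}$, with $v_2(\phi)=v_1(\phi)'$ for these three forms of $\phi$; - $v_2(\alpha\sqcup\beta)=v_2(\alpha)\cap v_2(\beta)$, $v_2(\lrcorner\alpha)=M\setminus v_2(\alpha)$, $v_2(\blacksquare\alpha)=\{m:\forall m_1\,(mSm_1\Rightarrow m_1\in v_2(\alpha))\}$, with $v_1(\phi)=v_2(\phi)'$ for these three forms of $\phi$. The model satisfies $\alpha\vdash\beta$ if $v_1(\alpha)\subseteq v_1(\beta)$ and $v_2(\beta)\subseteq v_2(\alpha)$, and it satisfies an s-hypersequent if it satisfies at least one of its components. An s-hypersequent is valid in a class of Kripke contexts if it is satisfied in every model based on a Kripke context in the class. Let $\mathcal{KC}_{RST}$ be the class of Kripke contexts in which both $R$ and $S$ are reflexive, symmetric and transitive. **Canonical relations.** Let $\mathcal L$ be the Lindenbaum–Tarski algebra of MPDBL5: the set of classes $[\alpha]$ of formulae modulo provability of both $\alpha\vdash\beta$ and $\beta\vdash\alpha$, with the operations induced by the connectives. Put $x\sqsubseteq y$ iff $x\sqcap y=x\sqcap x$ and $x\sqcup y=y\sqcup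 y$. A filter is a subset closed under $\sqcap$ and upward closed for $\sqsubseteq$; an ideal is a subset closed under $\sqcup$ and downward closed for $\sqsubseteq$. Let $\mathcal F_p$ be the set of filters $F$ such that $F\cap\mathcal L_\sqcap$ is a prime filter of the Boolean algebra $\mathcal L_\sqcap=\{x:x\sqcap x=x\}$ (meet $\sqcap$, join $\vee$, complement $\neg$), and $\mathcal I_p$ the set of ideals $J$ such that $J\cap\mathcal L_\sqcup$ is a prime ideal of the Boolean algebra $\mathcal L_\sqcup=\{x:x\sqcup x=x\}$ (join $\sqcup$, meet $\wedge$, complement $\lrcorner$). For $F,F_1\in\mathcal F_p$ let $F\,R\,F_1$ iff $\lozenge a\in F$ for all $a\in F_1$; for $J,J_1\in\mathcal I_p$ let $J\,S\,J_1$ iff $\blacklozenge a\in J$ for all $a\in J_1$. **Theorem.** 1. (Soundness) Every s-hypersequent provable in MPDBL5 is valid in $\mathcal{KC}_{RST}$. 2. (Completeness) Every s-hypersequent valid in $\mathcal{KC}_{RST}$ is provable in MPDBL5. 3. The canonical relations $R$ on $\mathcal F_p$ and $S$ on $\mathcal I_p$ are symmetric. -/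

import Mathlib

universe u v

namespace MPDBL

/-! ### Syntax -/

/-- Formulae over object variables `ov 0, ov 1, …` and property variables `pv 0, pv 1, …`. -/
inductive Formula : Type
  | top : Formula
  | bot : Formula
  | ov : ℕ → Formula
  | pv : ℕ → Formula
  | join : Formula → Formula → Formula
  | meet : Formula → Formula → Formula
  | neg : Formula → Formula
  | opp : Formula → Formula
  | box : Formula → Formula
  | bbox : Formula → Formula

infixl:65 " ⊔ₗ " => Formula.join
infixl:66 " ⊓ₗ " => Formula.meet
prefix:max "¬ₗ" => Formula.neg
prefix:max "⌟ₗ" => Formula.opp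
prefix:max "□ₗ" => Formula.box
prefix:max "■ₗ" => Formula.bbox

namespace Formula

/-- `α ∨ β := ¬(¬α ⊓ ¬β)`. -/
def vee (α β : Formula) : Formula := ¬ₗ(¬ₗα ⊓ₗ ¬ₗβ)

/-- `α ∧ β := ⌟(⌟α ⊔ ⌟β)`. -/
def wedge (α β : Formula) : Formula := ⌟ₗ(⌟ₗα ⊔ₗ ⌟ₗβ)

/-- The dual `◇α := ¬□¬α`. -/
def dia (α : Formula) : Formula := ¬ₗ(□ₗ(¬ₗα))

/-- The dual `◆α := ⌟■⌟α`. -/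
def bdia (α : Formula) : Formula := ⌟ₗ(■ₗ(⌟ₗα))

end Formula

infixl:65 " ∨ₗ " => Formula.vee
infixl:66 " ∧ₗ " => Formula.wedge
prefix:max "◇ₗ" => Formula.dia
prefix:max "◆ₗ" => Formula.bdia

/-- A sequent is a pair of formulae. -/
structure Sequent : Type where
  lhs : Formula
  rhs : Formula

infix:50 " ⊢ₗ " => Sequent.mk

/-- An s-hypersequent `α₁ ⊢ β₁ | … | αₙ ⊢ βₙ` is a (possibly empty) finite sequence of sequents. -/
abbrev Hypersequent : Type := List Sequent

/-! ### The proof systems -/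

open Formula in
/-- The axioms of `MPDBL`; an axiom written with `⊣⊢` is given by its two directions. -/
inductive IsAxiom : Sequent → Prop
  | ax1 (α) : IsAxiom (α ⊢ₗ α)
  | ax2a (α β) : IsAxiom (α ⊓ₗ β ⊢ₗ α)
  | ax2b (α β) : IsAxiom (α ⊢ₗ α ⊔ₗ β)
  | ax3a (α β) : IsAxiom (α ⊓ₗ β ⊢ₗ β)
  | ax3b (α β) : IsAxiom (β ⊢ₗ α ⊔ₗ β)
  | ax4a (α β) : IsAxiom (α ⊓ₗ β ⊢ₗ (α ⊓ₗ β) ⊓ₗ (α ⊓ₗ β))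
  | ax4b (α β) : IsAxiom ((α ⊔ₗ β) ⊔ₗ (α ⊔ₗ β) ⊢ₗ α ⊔ₗ β)
  | ax5a (α) : IsAxiom (¬ₗ(α ⊓ₗ α) ⊢ₗ ¬ₗα)
  | ax5b (α) : IsAxiom (⌟ₗα ⊢ₗ ⌟ₗ(α ⊔ₗ α))
  | ax6a (α) : IsAxiom (α ⊓ₗ ¬ₗα ⊢ₗ bot)
  | ax6b (α) : IsAxiom (top ⊢ₗ α ⊔ₗ ⌟ₗα)
  | ax7a_l (α β) : IsAxiom (¬ₗ(¬ₗ(α ⊓ₗ β)) ⊢ₗ α ⊓ₗ β)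
  | ax7a_r (α β) : IsAxiom (α ⊓ₗ β ⊢ₗ ¬ₗ(¬ₗ(α ⊓ₗ β)))
  | ax7b_l (α β) : IsAxiom (⌟ₗ(⌟ₗ(α ⊔ₗ β)) ⊢ₗ α ⊔ₗ β)
  | ax7b_r (α β) : IsAxiom (α ⊔ₗ β ⊢ₗ ⌟ₗ(⌟ₗ(α ⊔ₗ β)))
  | ax8a (α β) : IsAxiom (α ⊓ₗ α ⊢ₗ α ⊓ₗ (α ⊔ₗ β))
  | ax8b (α β) : IsAxiom (α ⊔ₗ (α ⊓ₗ β) ⊢ₗ α ⊔ₗ α)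
  | ax9a (α β) : IsAxiom (α ⊓ₗ α ⊢ₗ α ⊓ₗ (α ∨ₗ β))
  | ax9b (α β) : IsAxiom (α ⊔ₗ (α ∧ₗ β) ⊢ₗ α ⊔ₗ α)
  | ax10a_l (α β γ) : IsAxiom (α ⊓ₗ (β ∨ₗ γ) ⊢ₗ (α ⊓ₗ β) ∨ₗ (α ⊓ₗ γ))
  | ax10a_r (α β γ) : IsAxiom ((α ⊓ₗ β) ∨ₗ (α ⊓ₗ γ) ⊢ₗ α ⊓ₗ (β ∨ₗ γ))
  | ax10b_l (α β γ) : IsAxiom (α ⊔ₗ (β ∧ₗ γ) ⊢ₗ (α ⊔ₗ β) ∧ₗ (α ⊔ₗ γ))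
  | ax10b_r (α β γ) : IsAxiom ((α ⊔ₗ β) ∧ₗ (α ⊔ₗ γ) ⊢ₗ α ⊔ₗ (β ∧ₗ γ))
  | ax11a (α) : IsAxiom (bot ⊢ₗ α)
  | ax11b (α) : IsAxiom (α ⊢ₗ top)
  | ax12a : IsAxiom (¬ₗtop ⊢ₗ bot)
  | ax12b : IsAxiom (top ⊢ₗ ⌟ₗbot)
  | ax13a_l : IsAxiom (¬ₗbot ⊢ₗ top ⊓ₗ top)
  | ax13a_r : IsAxiom (top ⊓ₗ top ⊢ₗ ¬ₗbot)
  | ax13b_l : IsAxiom (⌟ₗtop ⊢ₗ bot ⊔ₗ bot)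
  | ax13b_r : IsAxiom (bot ⊔ₗ bot ⊢ₗ ⌟ₗtop)
  | ax14_l (α) : IsAxiom ((α ⊔ₗ α) ⊓ₗ (α ⊔ₗ α) ⊢ₗ (α ⊓ₗ α) ⊔ₗ (α ⊓ₗ α))
  | ax14_r (α) : IsAxiom ((α ⊓ₗ α) ⊔ₗ (α ⊓ₗ α) ⊢ₗ (α ⊔ₗ α) ⊓ₗ (α ⊔ₗ α))
  | ax15a_l (n : ℕ) : IsAxiom (ov n ⊓ₗ ov n ⊢ₗ ov n)
  | ax15a_r (n : ℕ) : IsAxiom (ov n ⊢ₗ ov n ⊓ₗ ov n)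
  | ax15b_l (n : ℕ) : IsAxiom (pv n ⊔ₗ pv n ⊢ₗ pv n)
  | ax15b_r (n : ℕ) : IsAxiom (pv n ⊢ₗ pv n ⊔ₗ pv n)
  | ax16a_l (α β) : IsAxiom (□ₗα ⊓ₗ □ₗβ ⊢ₗ □ₗ(α ⊓ₗ β))
  | ax16a_r (α β) : IsAxiom (□ₗ(α ⊓ₗ β) ⊢ₗ □ₗα ⊓ₗ □ₗβ)
  | ax16b_l (α β) : IsAxiom (■ₗα ⊔ₗ ■ₗβ ⊢ₗ ■ₗ(α ⊔ₗ β))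
  | ax16b_r (α β) : IsAxiom (■ₗ(α ⊔ₗ β) ⊢ₗ ■ₗα ⊔ₗ ■ₗβ)
  | ax17a_l : IsAxiom (□ₗ(¬ₗbot) ⊢ₗ ¬ₗbot)
  | ax17a_r : IsAxiom (¬ₗbot ⊢ₗ □ₗ(¬ₗbot))
  | ax17b_l : IsAxiom (■ₗ(⌟ₗtop) ⊢ₗ ⌟ₗtop)
  | ax17b_r : IsAxiom (⌟ₗtop ⊢ₗ ■ₗ(⌟ₗtop))
  | ax18a_l (α) : IsAxiom (□ₗ(α ⊓ₗ α) ⊢ₗ □ₗα)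
  | ax18a_r (α) : IsAxiom (□ₗα ⊢ₗ □ₗ(α ⊓ₗ α))
  | ax18b_l (α) : IsAxiom (■ₗ(α ⊔ₗ α) ⊢ₗ ■ₗα)
  | ax18b_r (α) : IsAxiom (■ₗα ⊢ₗ ■ₗ(α ⊔ₗ α))

/-- Derivability in `MPDBLΣ`, the logic obtained from `MPDBL` by adding the sequents in `Sig`
as axioms. The juxtaposition `B | C` of hypersequents is `B ++ C`. -/
inductive Provable (Sig : Set Sequent) : Hypersequent → Prop
  | ax {s} : IsAxiom s → Provable Sig [s]
  | extra {s} : s ∈ Sig → Provable Sig [s]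
  | r1 {B C : Hypersequent} {α β} (γ) : Provable Sig (B ++ [α ⊢ₗ β] ++ C) →
      Provable Sig (B ++ [α ⊓ₗ γ ⊢ₗ β ⊓ₗ γ] ++ C)
  | r1' {B C : Hypersequent} {α β} (γ) : Provable Sig (B ++ [α ⊢ₗ β] ++ C) →
      Provable Sig (B ++ [γ ⊓ₗ α ⊢ₗ γ ⊓ₗ β] ++ C)
  | r2 {B C : Hypersequent} {α β} (γ) : Provable Sig (B ++ [α ⊢ₗ β] ++ C) →
      Provable Sig (B ++ [α ⊔ₗ γ ⊢ₗ β ⊔ₗ γ] ++ C)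
  | r2' {B C : Hypersequent} {α β} (γ) : Provable Sig (B ++ [α ⊢ₗ β] ++ C) →
      Provable Sig (B ++ [γ ⊔ₗ α ⊢ₗ γ ⊔ₗ β] ++ C)
  | r3 {B C : Hypersequent} {α β} : Provable Sig (B ++ [α ⊢ₗ β] ++ C) →
      Provable Sig (B ++ [¬ₗβ ⊢ₗ ¬ₗα] ++ C)
  | r3' {B C : Hypersequent} {α β} : Provable Sig (B ++ [α ⊢ₗ β] ++ C) →
      Provable Sig (B ++ [⌟ₗβ ⊢ₗ ⌟ₗα] ++ C)
  | r4 {B C D E : Hypersequent} {α β γ} : Provable Sig (B ++ [α ⊢ₗ β] ++ C) →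
      Provable Sig (D ++ [β ⊢ₗ γ] ++ E) →
      Provable Sig (B ++ D ++ [α ⊢ₗ γ] ++ C ++ E)
  | sp (α) : Provable Sig [α ⊢ₗ α ⊓ₗ α, α ⊔ₗ α ⊢ₗ α]
  | r5 {B C D E F G H X : Hypersequent} {α β} :
      Provable Sig (B ++ [α ⊓ₗ β ⊢ₗ α ⊓ₗ α] ++ C) →
      Provable Sig (D ++ [α ⊓ₗ α ⊢ₗ α ⊓ₗ β] ++ E) →
      Provable Sig (F ++ [α ⊔ₗ β ⊢ₗ β ⊔ₗ β] ++ G) →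
      Provable Sig (H ++ [β ⊔ₗ β ⊢ₗ α ⊔ₗ β] ++ X) →
      Provable Sig (B ++ D ++ F ++ H ++ [α ⊢ₗ β] ++ C ++ E ++ G ++ X)
  | r8 {B C : Hypersequent} {α β} : Provable Sig (B ++ [α ⊢ₗ β] ++ C) →
      Provable Sig (B ++ [□ₗα ⊢ₗ □ₗβ] ++ C)
  | r9 {B C : Hypersequent} {α β} : Provable Sig (B ++ [α ⊢ₗ β] ++ C) →
      Provable Sig (B ++ [■ₗα ⊢ₗ ■ₗβ] ++ C)
  | ec {B C D : Hypersequent} : Provable Sig (B ++ D ++ D ++ C) → Provable Sig (B ++ D ++ C)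
  | ee {B C D E : Hypersequent} : Provable Sig (B ++ D ++ E ++ C) →
      Provable Sig (B ++ E ++ D ++ C)
  | ew {B : Hypersequent} (C : Hypersequent) : Provable Sig B → Provable Sig (B ++ C)

/-- The additional axioms of `MPDBL4`. -/
inductive MPDBL4 : Set Sequent
  | ax19a (α) : MPDBL4 (□ₗα ⊢ₗ α)
  | ax19b (α) : MPDBL4 (α ⊢ₗ ■ₗα)
  | ax20a_l (α) : MPDBL4 (□ₗ(□ₗα) ⊢ₗ □ₗα)
  | ax20a_r (α) : MPDBL4 (□ₗα ⊢ₗ □ₗ(□ₗα))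
  | ax20b_l (α) : MPDBL4 (■ₗ(■ₗα) ⊢ₗ ■ₗα)
  | ax20b_r (α) : MPDBL4 (■ₗα ⊢ₗ ■ₗ(■ₗα))

/-- The additional axioms of `MPDBL5`: those of `MPDBL4`, `◇α ⊢ □◇α` and `■◆α ⊢ ◆α`. -/
def MPDBL5 : Set Sequent :=
  MPDBL4 ∪ {s | ∃ α, s = (◇ₗα ⊢ₗ □ₗ(◇ₗα))} ∪ {s | ∃ α, s = (■ₗ(◆ₗα) ⊢ₗ ◆ₗα)}

/-! ### Kripke contexts and the relational semantics -/

/-- A Kripke context `((G, R), (M, S), I)`. -/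
structure KripkeContext : Type (max u v + 1) where
  G : Type u
  M : Type v
  I : G → M → Prop
  R : G → G → Prop
  S : M → M → Prop

/-- A semiconcept of the context `(G, M, I)`: a pair `(A, B)` with `A' = B` or `B' = A`. -/
@[ext]
structure Semiconcept {G : Type u} {M : Type v} (I : G → M → Prop) : Type (max u v) where
  extent : Set G
  intent : Set M
  isSemiconcept : upperPolar I extent = intent ∨ lowerPolar I intent = extent

namespace Semiconcept

variable {G : Type u} {M : Type v} {I : G → M → Prop}

/-- `(A₁, B₁) ⊓ (A₂, B₂) = (A₁ ∩ A₂, (A₁ ∩ A₂)')`. -/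
def meet (x y : Semiconcept I) : Semiconcept I :=
  ⟨x.extent ∩ y.extent, upperPolar I (x.extent ∩ y.extent), Or.inl rfl⟩

/-- `(A₁, B₁) ⊔ (A₂, B₂) = ((B₁ ∩ B₂)', B₁ ∩ B₂)`. -/
def join (x y : Semiconcept I) : Semiconcept I :=
  ⟨lowerPolar I (x.intent ∩ y.intent), x.intent ∩ y.intent, Or.inr rfl⟩

end Semiconcept

/-- A model based on a Kripke context: a valuation sending object variables to left semiconcepts
and property variables to right semiconcepts. (The values at `⊤`, `⊥` are forced to be `(G, ∅)` and
`(∅, M)`; they enter through the clauses for `⊤`, `⊥` below.) -/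
structure Model (K : KripkeContext.{u, v}) : Type (max u v) where
  ov : ℕ → Semiconcept K.I
  pv : ℕ → Semiconcept K.I
  ov_left : ∀ n, (ov n).meet (ov n) = ov n
  pv_right : ∀ n, (pv n).join (pv n) = pv n

mutual

/-- Satisfaction `g ⊨ α` of a formula at an object. -/
def Model.Sat {K : KripkeContext.{u, v}} (V : Model K) : Formula → K.G → Prop
  | .top, _ => True
  | .bot, _ => False
  | .ov n, g => g ∈ (V.ov n).extent
  | .pv n, g => g ∈ (V.pv n).extent
  | .meet α β, g => V.Sat α g ∧ V.Sat β g
  | .join α β, g => ∀ m, (V.CoSat α m ∧ V.CoSat β m) → K.I g m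
  | .neg α, g => ¬ V.Sat α g
  | .opp α, g => ∀ m, ¬ V.CoSat α m → K.I g m
  | .box α, g => ∀ g₁, K.R g g₁ → V.Sat α g₁
  | .bbox α, g => ∀ m, (∀ m₁, K.S m m₁ → V.CoSat α m₁) → K.I g m

/-- Co-satisfaction `m ≻ α` of a formula at a property. -/
def Model.CoSat {K : KripkeContext.{u, v}} (V : Model K) : Formula → K.M → Prop
  | .top, _ => False
  | .bot, _ => True
  | .ov n, m => m ∈ (V.ov n).intent
  | .pv n, m => m ∈ (V.pv n).intent
  | .meet α β, m => ∀ g, (V.Sat α g ∧ V.Sat β g) → K.I g m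
  | .join α β, m => V.CoSat α m ∧ V.CoSat β m
  | .neg α, m => ∀ g, ¬ V.Sat α g → K.I g m
  | .opp α, m => ¬ V.CoSat α m
  | .box α, m => ∀ g, (∀ g₁, K.R g g₁ → V.Sat α g₁) → K.I g m
  | .bbox α, m => ∀ m₁, K.S m m₁ → V.CoSat α m₁

end

/-- Satisfaction of a sequent in a model. -/
def Model.SatSequent {K : KripkeContext.{u, v}} (V : Model K) (s : Sequent) : Prop :=
  (∀ g, V.Sat s.lhs g → V.Sat s.rhs g) ∧ (∀ m, V.CoSat s.rhs m → V.CoSat s.lhs m)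

/-- A hypersequent is satisfied in a model if at least one of its components is. -/
def Model.SatHyper {K : KripkeContext.{u, v}} (V : Model K) (H : Hypersequent) : Prop :=
  ∃ s ∈ H, V.SatSequent s

/-- A hypersequent is true in a Kripke context if it is satisfied in all models based on it. -/
def KripkeContext.IsTrue (K : KripkeContext.{u, v}) (H : Hypersequent) : Prop :=
  ∀ V : Model K, V.SatHyper H

/-- Validity in a class of Kripke contexts. -/
def Valid (𝒦 : Set KripkeContext.{u, v}) (H : Hypersequent) : Prop :=
  ∀ K ∈ 𝒦, K.IsTrue H

/-- The class of all reflexive, symmetric and transitive Kripke contexts. -/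
def KCRST : Set KripkeContext.{u, v} :=
  {K | (Std.Refl K.R ∧ Std.Refl K.S) ∧ (Std.Symm K.R ∧ Std.Symm K.S) ∧
    (IsTrans K.G K.R ∧ IsTrans K.M K.S)}

/-! ### The Lindenbaum–Tarski algebra of `MPDBLΣ` and the canonical relations -/

variable (Sig : Set Sequent)

/-- `α ≡ β` if and only if `α ⊢ β` and `β ⊢ α` are provable. -/
def ltSetoid : Setoid Formula where
  r α β := Provable Sig [α ⊢ₗ β] ∧ Provable Sig [β ⊢ₗ α]
  iseqv :=
    { refl := fun α => ⟨.ax (.ax1 α), .ax (.ax1 α)⟩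
      symm := fun h => ⟨h.2, h.1⟩
      trans := fun h k =>
        ⟨Provable.r4 (B := []) (C := []) (D := []) (E := []) h.1 k.1,
          Provable.r4 (B := []) (C := []) (D := []) (E := []) k.2 h.2⟩ }

/-- The carrier of the Lindenbaum–Tarski algebra. -/
def LT : Type := Quotient (ltSetoid Sig)

namespace LT

variable {Sig}

/-- The class `[α]`. -/
def mk (α : Formula) : LT Sig := Quotient.mk (ltSetoid Sig) α

theorem meet_congr {α α' β β' : Formula} (h : ltSetoid Sig α α') (k : ltSetoid Sig β β') :
    ltSetoid Sig (α ⊓ₗ β) (α' ⊓ₗ β') :=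
  (ltSetoid Sig).trans
    ⟨Provable.r1 (B := []) (C := []) β h.1, Provable.r1 (B := []) (C := []) β h.2⟩
    ⟨Provable.r1' (B := []) (C := []) α' k.1, Provable.r1' (B := []) (C := []) α' k.2⟩

theorem join_congr {α α' β β' : Formula} (h : ltSetoid Sig α α') (k : ltSetoid Sig β β') :
    ltSetoid Sig (α ⊔ₗ β) (α' ⊔ₗ β') :=
  (ltSetoid Sig).trans
    ⟨Provable.r2 (B := []) (C := []) β h.1, Provable.r2 (B := []) (C := []) β h.2⟩
    ⟨Provable.r2' (B := []) (C := []) α' k.1, Provable.r2' (B := []) (C := []) α' k.2⟩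

/-- `[α] ⊓ [β] = [α ⊓ β]`. -/
def meet (a b : LT Sig) : LT Sig :=
  Quotient.liftOn₂ a b (fun α β => mk (α ⊓ₗ β)) fun _ _ _ _ h k =>
    Quotient.sound (meet_congr h k)

/-- `[α] ⊔ [β] = [α ⊔ β]`. -/
def join (a b : LT Sig) : LT Sig :=
  Quotient.liftOn₂ a b (fun α β => mk (α ⊔ₗ β)) fun _ _ _ _ h k =>
    Quotient.sound (join_congr h k)

/-- `¬[α] = [¬α]`. -/
def neg (a : LT Sig) : LT Sig :=
  Quotient.liftOn a (fun α => mk (¬ₗα)) fun _ _ h => Quotient.sound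
    ⟨Provable.r3 (B := []) (C := []) h.2, Provable.r3 (B := []) (C := []) h.1⟩

/-- `⌟[α] = [⌟α]`. -/
def opp (a : LT Sig) : LT Sig :=
  Quotient.liftOn a (fun α => mk (⌟ₗα)) fun _ _ h => Quotient.sound
    ⟨Provable.r3' (B := []) (C := []) h.2, Provable.r3' (B := []) (C := []) h.1⟩

/-- The operator `f_□`, `[α] ↦ [□α]`. -/
def box (a : LT Sig) : LT Sig :=
  Quotient.liftOn a (fun α => mk (□ₗα)) fun _ _ h => Quotient.sound
    ⟨Provable.r8 (B := []) (C := []) h.1, Provable.r8 (B := []) (C := []) h.2⟩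

/-- The operator `f_■`, `[α] ↦ [■α]`. -/
def bbox (a : LT Sig) : LT Sig :=
  Quotient.liftOn a (fun α => mk (■ₗα)) fun _ _ h => Quotient.sound
    ⟨Provable.r9 (B := []) (C := []) h.1, Provable.r9 (B := []) (C := []) h.2⟩

/-- `x ∨ y := ¬(¬x ⊓ ¬y)`. -/
def vee (a b : LT Sig) : LT Sig := neg (meet (neg a) (neg b))

/-- `x ∧ y := ⌟(⌟x ⊔ ⌟y)`. -/
def wedge (a b : LT Sig) : LT Sig := opp (join (opp a) (opp b))

/-- The dual operator `f_◇(a) = ¬ f_□(¬a)`. -/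
def dia (a : LT Sig) : LT Sig := neg (box (neg a))

/-- The dual operator `f_◆(a) = ⌟ f_■(⌟a)`. -/
def bdia (a : LT Sig) : LT Sig := opp (bbox (opp a))

/-- The relation `x ⊑ y`: `x ⊓ y = x ⊓ x` and `x ⊔ y = y ⊔ y`. -/
def Le (a b : LT Sig) : Prop := meet a b = meet a a ∧ join a b = join b b

variable (Sig)

/-- The set `D_⊓` of `⊓`-idempotents, a Boolean algebra with meet `⊓`, join `∨`, complement `¬`. -/
def meetPart : Set (LT Sig) := {a | meet a a = a}

/-- The set `D_⊔` of `⊔`-idempotents, a Boolean algebra with join `⊔`, meet `∧`, complement `⌟`. -/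
def joinPart : Set (LT Sig) := {a | join a a = a}

variable {Sig}

/-- Filters. -/
structure IsFilter (F : Set (LT Sig)) : Prop where
  meet_mem : ∀ ⦃a b⦄, a ∈ F → b ∈ F → meet a b ∈ F
  up_mem : ∀ ⦃a b⦄, a ∈ F → Le a b → b ∈ F

/-- Ideals. -/
structure IsIdeal (J : Set (LT Sig)) : Prop where
  join_mem : ∀ ⦃a b⦄, a ∈ J → b ∈ J → join a b ∈ J
  down_mem : ∀ ⦃a b⦄, b ∈ J → Le a b → a ∈ J

variable (Sig)

/-- The filters `F` for which `F ∩ D_⊓` is a prime filter of the Boolean algebra `D_⊓`, i.e. a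
nonempty proper filter containing `a` or `b` whenever it contains `a ∨ b`. (For a filter `F` the set
`F ∩ D_⊓` is automatically closed under `⊓` and upward closed in `D_⊓`.) -/
def primeFilters : Set (Set (LT Sig)) :=
  {F | IsFilter F ∧ (F ∩ meetPart Sig).Nonempty ∧ F ∩ meetPart Sig ≠ meetPart Sig ∧
    ∀ a ∈ meetPart Sig, ∀ b ∈ meetPart Sig, vee a b ∈ F → a ∈ F ∨ b ∈ F}

/-- The ideals `J` for which `J ∩ D_⊔` is a prime ideal of the Boolean algebra `D_⊔`. -/
def primeIdeals : Set (Set (LT Sig)) :=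
  {J | IsIdeal J ∧ (J ∩ joinPart Sig).Nonempty ∧ J ∩ joinPart Sig ≠ joinPart Sig ∧
    ∀ a ∈ joinPart Sig, ∀ b ∈ joinPart Sig, wedge a b ∈ J → a ∈ J ∨ b ∈ J}

/-- The canonical relation `R`: `F R F₁` if and only if `f_◇(a) ∈ F` for all `a ∈ F₁`. -/
def canonicalR (F F₁ : primeFilters Sig) : Prop := ∀ a ∈ F₁.1, dia a ∈ F.1

/-- The canonical relation `S`: `J S J₁` if and only if `f_◆(a) ∈ J` for all `a ∈ J₁`. -/
def canonicalS (J J₁ : primeIdeals Sig) : Prop := ∀ a ∈ J₁.1, bdia a ∈ J.1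

end LT

end MPDBL

-- Soundness is an induction on derivations. It rests on one semantic fact, `Model.left_or_right`:
-- in every interpreted pair, one coordinate is the polar of the other.
--
-- Completeness comes from a single canonical model that satisfies only provable sequents. The
-- Lindenbaum–Tarski algebra is a double Boolean algebra with two S5 operators, axiomatised by
-- `ModalDBA` in a self-dual way, so every fact about filters yields the fact about ideals through
-- `dual`. Its `⊓`-idempotents form a distributive lattice, and the prime ideal theorem there gives
-- enough prime filters: they interpret `□` (`box_mem_iff`), they decide the order together with the
-- prime ideals (`le_of_forall`), and under the incidence "`F` meets `J`" they determine which prime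
-- ideals contain a `⊓`-idempotent (`mem_ideal_iff`). This gives the truth lemma. A valid
-- hypersequent has a component satisfied in the canonical model; that component is provable, and
-- weakening restores the others.
--
-- The canonical relations inherit reflexivity, transitivity and symmetry from the axioms T, 4 and
-- 5.

open Order

-- Double Boolean algebras with S5 operators

/-- A double Boolean algebra with a pair of `S5` operators. Every axiom comes with its dual, so the
structure is stable under exchanging the two halves. -/
structure ModalDBA (D : Type*) where
  le : D → D → Prop
  meet : D → D → D
  join : D → D → D
  neg : D → D
  opp : D → D
  box : D → D
  bbox : D → D
  top : D
  bot : D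
  refl : ∀ x, le x x
  trans : ∀ {x y z}, le x y → le y z → le x z
  antisymm : ∀ {x y}, le x y → le y x → x = y
  le_of_le : ∀ {x y}, le (meet x x) y → le x (join y y) → le x y
  bot_le : ∀ x, le bot x
  le_top : ∀ x, le x top
  meet_le_left : ∀ x y, le (meet x y) x
  le_join_left : ∀ x y, le x (join x y)
  meet_le_right : ∀ x y, le (meet x y) y
  le_join_right : ∀ x y, le y (join x y)
  meet_mono : ∀ {x x' y y'}, le x x' → le y y' → le (meet x y) (meet x' y')
  join_mono : ∀ {x x' y y'}, le x x' → le y y' → le (join x y) (join x' y')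
  le_meet_meet : ∀ x y, le (meet x y) (meet (meet x y) (meet x y))
  join_join_le : ∀ x y, le (join (join x y) (join x y)) (join x y)
  neg_anti : ∀ {x y}, le x y → le (neg y) (neg x)
  opp_anti : ∀ {x y}, le x y → le (opp y) (opp x)
  neg_meet_self_le : ∀ x, le (neg (meet x x)) (neg x)
  le_opp_join_self : ∀ x, le (opp x) (opp (join x x))
  meet_neg_le : ∀ x, le (meet x (neg x)) bot
  le_join_opp : ∀ x, le top (join x (opp x))
  neg_neg_meet : ∀ x y, neg (neg (meet x y)) = meet x y
  opp_opp_join : ∀ x y, opp (opp (join x y)) = join x y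
  meet_self_le : ∀ x y, le (meet x x) (meet x (neg (meet (neg x) (neg y))))
  le_join_self : ∀ x y, le (join x (opp (join (opp x) (opp y)))) (join x x)
  meet_vee_le : ∀ x y z, le (meet x (neg (meet (neg y) (neg z))))
    (neg (meet (neg (meet x y)) (neg (meet x z))))
  le_join_wedge : ∀ x y z, le (opp (join (opp (join x y)) (opp (join x z))))
    (join x (opp (join (opp y) (opp z))))
  neg_bot : neg bot = meet top top
  opp_top : opp top = join bot bot
  box_mono : ∀ {x y}, le x y → le (box x) (box y)
  bbox_mono : ∀ {x y}, le x y → le (bbox x) (bbox y)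
  box_meet : ∀ x y, meet (box x) (box y) = box (meet x y)
  bbox_join : ∀ x y, join (bbox x) (bbox y) = bbox (join x y)
  box_neg_bot : box (neg bot) = neg bot
  bbox_opp_top : bbox (opp top) = opp top
  box_meet_self : ∀ x, box (meet x x) = box x
  bbox_join_self : ∀ x, bbox (join x x) = bbox x
  box_le : ∀ x, le (box x) x
  le_bbox : ∀ x, le x (bbox x)
  box_box : ∀ x, box (box x) = box x
  bbox_bbox : ∀ x, bbox (bbox x) = bbox x
  dia_le : ∀ x, le (neg (box (neg x))) (box (neg (box (neg x))))
  le_bdia : ∀ x, le (bbox (opp (bbox (opp x)))) (opp (bbox (opp x)))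

namespace ModalDBA

variable {D : Type*} (A : ModalDBA D)

/-- The order dual, on the same carrier. -/
def dual : ModalDBA D where
  le x y := A.le y x
  meet := A.join
  join := A.meet
  neg := A.opp
  opp := A.neg
  box := A.bbox
  bbox := A.box
  top := A.bot
  bot := A.top
  refl := A.refl
  trans h k := A.trans k h
  antisymm h k := A.antisymm k h
  le_of_le h k := A.le_of_le k h
  bot_le := A.le_top
  le_top := A.bot_le
  meet_le_left := A.le_join_left
  le_join_left := A.meet_le_left
  meet_le_right := A.le_join_right
  le_join_right := A.meet_le_right
  meet_mono h k := A.join_mono h k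
  join_mono h k := A.meet_mono h k
  le_meet_meet := A.join_join_le
  join_join_le := A.le_meet_meet
  neg_anti h := A.opp_anti h
  opp_anti h := A.neg_anti h
  neg_meet_self_le := A.le_opp_join_self
  le_opp_join_self := A.neg_meet_self_le
  meet_neg_le := A.le_join_opp
  le_join_opp := A.meet_neg_le
  neg_neg_meet := A.opp_opp_join
  opp_opp_join := A.neg_neg_meet
  meet_self_le := A.le_join_self
  le_join_self := A.meet_self_le
  meet_vee_le := A.le_join_wedge
  le_join_wedge := A.meet_vee_le
  neg_bot := A.opp_top
  opp_top := A.neg_bot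
  box_mono h := A.bbox_mono h
  bbox_mono h := A.box_mono h
  box_meet := A.bbox_join
  bbox_join := A.box_meet
  box_neg_bot := A.bbox_opp_top
  bbox_opp_top := A.box_neg_bot
  box_meet_self := A.bbox_join_self
  bbox_join_self := A.box_meet_self
  box_le := A.le_bbox
  le_bbox := A.box_le
  box_box := A.bbox_bbox
  bbox_bbox := A.box_box
  dia_le := A.le_bdia
  le_bdia := A.dia_le

-- The lattice of `⊓`-idempotents

/-- `x ∨ y := ¬(¬x ⊓ ¬y)`. -/
def vee (x y : D) : D := A.neg (A.meet (A.neg x) (A.neg y))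

/-- The dual operator `¬ □ ¬`. -/
def dia (x : D) : D := A.neg (A.box (A.neg x))

/-- The `⊓`-idempotents. -/
def Idem (x : D) : Prop := A.meet x x = x

theorem idem_meet (x y : D) : A.Idem (A.meet x y) :=
  A.antisymm (A.meet_le_left _ _) (A.le_meet_meet _ _)

theorem le_meet_of_idem {x y z : D} (hz : A.Idem z) (hx : A.le z x) (hy : A.le z y) :
    A.le z (A.meet x y) := by
  have := A.meet_mono hx hy
  rwa [hz] at this

theorem neg_meet_self (x : D) : A.neg (A.meet x x) = A.neg x :=
  A.antisymm (A.neg_meet_self_le x) (A.neg_anti (A.meet_le_left x x))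

theorem neg_neg (x : D) : A.neg (A.neg x) = A.meet x x := by
  rw [← A.neg_meet_self x, A.neg_neg_meet]

theorem idem_neg (x : D) : A.Idem (A.neg x) := by
  rw [Idem, ← A.neg_neg (A.neg x), A.neg_neg x, A.neg_meet_self]

theorem idem_vee (x y : D) : A.Idem (A.vee x y) := A.idem_neg _

theorem idem_box (x : D) : A.Idem (A.box x) := by
  rw [Idem, A.box_meet, A.box_meet_self]

theorem neg_neg_of_idem {x : D} (hx : A.Idem x) : A.neg (A.neg x) = x := by
  rw [A.neg_neg, hx]

theorem meet_comm (x y : D) : A.meet x y = A.meet y x :=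
  have key : ∀ x y, A.le (A.meet x y) (A.meet y x) := fun x y =>
    A.le_meet_of_idem (A.idem_meet x y) (A.meet_le_right x y) (A.meet_le_left x y)
  A.antisymm (key x y) (key y x)

theorem le_vee_left {x : D} (hx : A.Idem x) (y : D) : A.le x (A.vee x y) := by
  have := A.trans (A.meet_self_le x y) (A.meet_le_right _ _)
  rwa [hx] at this

theorem vee_comm (x y : D) : A.vee x y = A.vee y x := by
  rw [vee, A.meet_comm, vee]

theorem le_vee_right (x : D) {y : D} (hy : A.Idem y) : A.le y (A.vee x y) :=
  A.vee_comm y x ▸ A.le_vee_left hy x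

/-- `¬z` is idempotent and lies below `¬x` and `¬y`, hence below `¬x ⊓ ¬y`; negating gives `x ∨ y`
below `¬¬z = z ⊓ z`. -/
theorem vee_le_meet_self {x y z : D} (hx : A.le x z) (hy : A.le y z) :
    A.le (A.vee x y) (A.meet z z) := by
  rw [← A.neg_neg z]
  exact A.neg_anti (A.le_meet_of_idem (A.idem_neg z) (A.neg_anti hx) (A.neg_anti hy))

theorem vee_le {x y z : D} (hx : A.le x z) (hy : A.le y z) : A.le (A.vee x y) z :=
  A.trans (A.vee_le_meet_self hx hy) (A.meet_le_left z z)

/-- The `⊓`-idempotents form a distributive lattice. -/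
abbrev idemDistribLattice : DistribLattice {x // A.Idem x} :=
  letI : Lattice {x // A.Idem x} :=
    { le := fun x y => A.le x.1 y.1
      le_refl := fun x => A.refl x.1
      le_trans := fun _ _ _ h k => A.trans h k
      le_antisymm := fun _ _ h k => Subtype.ext (A.antisymm h k)
      inf := fun x y => ⟨A.meet x.1 y.1, A.idem_meet _ _⟩
      sup := fun x y => ⟨A.vee x.1 y.1, A.idem_vee _ _⟩
      inf_le_left := fun _ _ => A.meet_le_left _ _
      inf_le_right := fun _ _ => A.meet_le_right _ _
      le_inf := fun x _ _ h k => A.le_meet_of_idem x.2 h k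
      le_sup_left := fun x y => A.le_vee_left x.2 y.1
      le_sup_right := fun x y => A.le_vee_right x.1 y.2
      sup_le := fun _ _ _ h k => A.vee_le h k }
  DistribLattice.ofInfSupLe fun x y z => A.meet_vee_le x.1 y.1 z.1

-- Prime filters and separation

/-- Filters. -/
structure IsFilter (F : Set D) : Prop where
  meet_mem : ∀ ⦃x y⦄, x ∈ F → y ∈ F → A.meet x y ∈ F
  up_mem : ∀ ⦃x y⦄, x ∈ F → A.le x y → y ∈ F

/-- The filters whose trace on the `⊓`-idempotents is a prime filter. -/
structure IsPrimeFilter (F : Set D) : Prop extends A.IsFilter F where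
  top_mem : A.top ∈ F
  bot_notMem : A.bot ∉ F
  mem_or_mem : ∀ ⦃x y⦄, A.Idem x → A.Idem y → A.vee x y ∈ F → x ∈ F ∨ y ∈ F

/-- Separation of a filter from an ideal by a prime filter. -/
theorem exists_isPrimeFilter {Φ J : Set D} (hΦ : A.IsFilter Φ) (htop : A.top ∈ Φ)
    (hbot : A.bot ∈ J) (hdown : ∀ ⦃x y⦄, y ∈ J → A.le x y → x ∈ J)
    (hvee : ∀ ⦃x y⦄, A.Idem x → A.Idem y → x ∈ J → y ∈ J → A.vee x y ∈ J)
    (hdisj : Disjoint Φ J) : ∃ F, A.IsPrimeFilter F ∧ Φ ⊆ F ∧ Disjoint F J := by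
  let _ := A.idemDistribLattice
  have hbotI : A.Idem A.bot := A.antisymm (A.meet_le_left _ _) (A.bot_le _)
  have hF : IsPFilter {x : {x // A.Idem x} | x.1 ∈ Φ} := by
    refine IsPFilter.of_def ⟨⟨A.meet A.top A.top, A.idem_meet _ _⟩, hΦ.meet_mem htop htop⟩ ?_ ?_
    · exact fun x hx y hy => ⟨x ⊓ y, hΦ.meet_mem hx hy, inf_le_left, inf_le_right⟩
    · exact fun h hx => hΦ.up_mem hx h
  have hI : IsIdeal {x : {x // A.Idem x} | x.1 ∈ J} := by
    refine ⟨fun x y h hx => hdown hx h, ⟨⟨A.bot, hbotI⟩, hbot⟩, ?_⟩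
    exact fun x hx y hy => ⟨x ⊔ y, hvee x.2 y.2 hx hy, le_sup_left, le_sup_right⟩
  -- The prime ideal theorem applies to the traces of `Φ` and `J` on the idempotents.
  obtain ⟨P, hP, hIP, hFP⟩ :=
    DistribLattice.prime_ideal_of_disjoint_filter_ideal (F := hF.toPFilter) (I := hI.toIdeal)
      (Set.disjoint_left.2 fun x hx hx' => Set.disjoint_left.1 hdisj hx hx')
  have hFP' : ∀ x : {x // A.Idem x}, x.1 ∈ Φ → x ∉ P := fun x hx => Set.disjoint_left.1 hFP hx
  -- The complement of `P` is a prime filter of idempotents only; it extends to all of `D` by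
  -- testing `x` through its idempotent part `x ⊓ x`.
  refine ⟨{x | (⟨A.meet x x, A.idem_meet x x⟩ : {x // A.Idem x}) ∉ P}, ⟨⟨?_, ?_⟩, ?_, ?_, ?_⟩, ?_, ?_⟩
  · intro x y hx hy h
    have : (⟨A.meet x x, A.idem_meet x x⟩ ⊓ ⟨A.meet y y, A.idem_meet y y⟩ : {x // A.Idem x}) ∈ P := by
      refine P.lower ?_ h
      exact A.le_meet_of_idem (A.idem_meet _ _)
        (A.meet_mono (A.meet_le_left x x) (A.meet_le_left y y))
        (A.meet_mono (A.meet_le_left x x) (A.meet_le_left y y))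
    exact (hP.mem_or_mem this).elim hx hy
  · exact fun x y hx h hy => hx (P.lower (A.meet_mono h h) hy)
  · exact hFP' _ (hΦ.meet_mem htop htop)
  · exact fun h => h (hIP (show A.meet A.bot A.bot ∈ J by rwa [hbotI]))
  · intro x y hx hy h
    by_contra! hc
    simp only [Set.mem_ofPred_eq, not_not] at hc
    refine h ?_
    convert P.sup_mem hc.1 hc.2 using 1
    refine Subtype.ext ?_
    change A.meet (A.vee x y) (A.vee x y) = A.vee (A.meet x x) (A.meet y y)
    rw [A.idem_vee, hx, hy]
  · exact fun x hx => hFP' _ (hΦ.meet_mem hx hx)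
  · exact Set.disjoint_left.2 fun x hx hx' => hx (hIP (hdown hx' (A.meet_le_left x x)))

namespace IsPrimeFilter

variable {A} {F F₁ : Set D}

theorem meet_mem_iff (hF : A.IsPrimeFilter F) {x y : D} : A.meet x y ∈ F ↔ x ∈ F ∧ y ∈ F :=
  ⟨fun h => ⟨hF.up_mem h (A.meet_le_left x y), hF.up_mem h (A.meet_le_right x y)⟩,
    fun h => hF.meet_mem h.1 h.2⟩

/-- Consistency is `x ⊓ ¬x ≤ ⊥`. For completeness, `(x ⊓ x) ∨ ¬x` lies above `¬⊥ = ⊤ ⊓ ⊤`, which is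
in `F`; primeness speaks only of idempotents, hence `x ⊓ x` in place of `x`. -/
theorem neg_mem_iff (hF : A.IsPrimeFilter F) {x : D} : A.neg x ∈ F ↔ x ∉ F := by
  refine ⟨fun h hx => hF.bot_notMem (hF.up_mem (hF.meet_mem hx h) (A.meet_neg_le x)), fun hx => ?_⟩
  have h : A.vee (A.meet x x) (A.neg x) ∈ F := by
    have h1 : A.neg A.bot ∈ F := by
      rw [A.neg_bot]
      exact hF.meet_mem hF.top_mem hF.top_mem
    refine hF.up_mem h1 (A.neg_anti ?_)
    rw [A.neg_meet_self]
    exact A.meet_neg_le _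
  exact (hF.mem_or_mem (A.idem_meet x x) (A.idem_neg x) h).resolve_left
    fun h => hx (hF.meet_mem_iff.1 h).1

theorem dia_mem_iff (hF : A.IsPrimeFilter F) {x : D} : A.dia x ∈ F ↔ A.box (A.neg x) ∉ F :=
  hF.neg_mem_iff

end IsPrimeFilter

-- The canonical relation and the modal operator

/-- The canonical relation. -/
def Rel (F F₁ : Set D) : Prop := ∀ x ∈ F₁, A.dia x ∈ F

variable {A} {F F₁ F₂ : Set D}

theorem rel_refl (hF : A.IsPrimeFilter F) : A.Rel F F := fun _ hx =>
  hF.dia_mem_iff.2 fun h => hF.neg_mem_iff.1 (hF.up_mem h (A.box_le _)) hx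

/-- Two steps put `◇◇x` in `F`, and `◇◇x = ¬□□¬x = ◇x`. -/
theorem rel_trans (hF : A.IsPrimeFilter F) (h : A.Rel F F₁) (k : A.Rel F₁ F₂) : A.Rel F F₂ := by
  intro x hx
  have := h _ (k x hx)
  rw [hF.dia_mem_iff, dia, A.neg_neg_of_idem (A.idem_box _), A.box_box] at this
  exact hF.dia_mem_iff.2 this

/-- Suppose `x ∈ F` but `◇x ∉ F₁`. Then `¬◇x ∈ F₁`, so `◇¬◇x = ¬□◇x` is in `F`. Yet `◇x ∈ F` by
reflexivity, hence `□◇x ∈ F` by axiom 5. -/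
theorem rel_symm (hF : A.IsPrimeFilter F) (hF₁ : A.IsPrimeFilter F₁) (h : A.Rel F F₁) :
    A.Rel F₁ F := by
  intro x hx
  by_contra hc
  have := h _ (hF₁.neg_mem_iff.2 hc)
  rw [hF.dia_mem_iff, A.neg_neg_of_idem (x := A.dia x) (A.idem_neg _)] at this
  exact this (hF.up_mem (rel_refl hF x hx) (A.dia_le x))

/-- If `□x ∉ F`, the filter `{y | □y ∈ F}` misses `{y | y ⊓ y ≤ x}`, because `□y = □(y ⊓ y)`. A
prime filter `F₁` separating them omits `x`, and it is related to `F`: `□¬y ∈ F` would put `¬y` in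
`F₁`. -/
theorem box_mem_iff (hF : A.IsPrimeFilter F) {x : D} :
    A.box x ∈ F ↔ ∀ F₁, A.IsPrimeFilter F₁ → A.Rel F F₁ → x ∈ F₁ := by
  constructor
  · intro h F₁ hF₁ hR
    by_contra hx
    have := hR _ (hF₁.neg_mem_iff.2 hx)
    rw [hF.dia_mem_iff, A.neg_neg, A.box_meet_self] at this
    exact this h
  · intro h
    by_contra hx
    obtain ⟨F₁, hF₁, hsub, hdisj⟩ := A.exists_isPrimeFilter
      (Φ := {y | A.box y ∈ F}) (J := {y | A.le (A.meet y y) x})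
      ⟨fun y z hy hz => by
          rw [Set.mem_ofPred_eq, ← A.box_meet]
          exact hF.meet_mem hy hz,
        fun y z hy hyz => hF.up_mem hy (A.box_mono hyz)⟩
      (by
        -- Necessitation: `¬⊥ = □¬⊥ ≤ □⊤`.
        refine hF.up_mem (x := A.neg A.bot) ?_ ?_
        · exact hF.neg_mem_iff.2 hF.bot_notMem
        · rw [← A.box_neg_bot]
          exact A.box_mono (A.le_top _))
      (A.trans (A.meet_le_left _ _) (A.bot_le _))
      (fun y z hz hyz => A.trans (A.meet_mono hyz hyz) hz)
      (fun y z hy hz hyx hzx => by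
        rw [Set.mem_ofPred_eq, hy] at hyx
        rw [Set.mem_ofPred_eq, hz] at hzx
        exact A.trans (A.meet_le_left _ _) (A.vee_le hyx hzx))
      (Set.disjoint_left.2 fun y hy hyx => hx <| by
        rw [Set.mem_ofPred_eq, ← A.box_meet_self] at hy
        exact hF.up_mem hy (A.box_mono hyx))
    refine Set.disjoint_left.1 hdisj (h F₁ hF₁ fun y hy => ?_) (A.meet_le_left x x)
    exact hF.dia_mem_iff.2 fun hc => hF₁.neg_mem_iff.1 (hsub hc) hy

-- Order and incidence recovered from prime filters and prime ideals

theorem isFilter_Ici {x : D} (hx : A.Idem x) : A.IsFilter {y | A.le x y} :=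
  ⟨fun _ _ hy hz => A.le_meet_of_idem hx hy hz, fun _ _ hy hyz => A.trans hy hyz⟩

/-- A prime filter contains `x` exactly when it contains `x ⊓ x`, so prime filters can bound only `x
⊓ x`. The bound comes from separating the principal filter of `x ⊓ x` from `{z | z ⊓ z ≤ y}`. -/
theorem meet_self_le_of_forall {x y : D} (h : ∀ F, A.IsPrimeFilter F → x ∈ F → y ∈ F) :
    A.le (A.meet x x) y := by
  by_contra hc
  obtain ⟨F, hF, hsub, hdisj⟩ := A.exists_isPrimeFilter (J := {z | A.le (A.meet z z) y})
    (isFilter_Ici (A.idem_meet x x)) (A.le_top _)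
    (A.trans (A.meet_le_left _ _) (A.bot_le _))
    (fun _ _ hz hyz => A.trans (A.meet_mono hyz hyz) hz)
    (fun z w hz hw hzy hwy => by
      rw [Set.mem_ofPred_eq, hz] at hzy
      rw [Set.mem_ofPred_eq, hw] at hwy
      exact A.trans (A.meet_le_left _ _) (A.vee_le hzy hwy))
    (Set.disjoint_left.2 fun z (hz : A.le _ z) hzy => hc <| by
      have := A.meet_mono hz hz
      rw [A.idem_meet x x] at this
      exact A.trans this hzy)
  exact Set.disjoint_left.1 hdisj (h F hF (hsub (A.meet_le_left x x))) (A.meet_le_left y y)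

/-- Filters give `x ⊓ x ≤ y`, ideals give `x ≤ y ⊔ y`, and `le_of_le` combines the two halves. -/
theorem le_of_forall {x y : D} (h : ∀ F, A.IsPrimeFilter F → x ∈ F → y ∈ F)
    (k : ∀ J, A.dual.IsPrimeFilter J → y ∈ J → x ∈ J) : A.le x y :=
  A.le_of_le (meet_self_le_of_forall h) (meet_self_le_of_forall (A := A.dual) k)

/-- At a `⊓`-idempotent, the prime ideals containing it are determined by the prime filters
containing it through the incidence relation of the canonical context. -/
theorem mem_ideal_iff {J : Set D} (hJ : A.dual.IsPrimeFilter J) {x : D} (hx : A.Idem x) :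
    x ∈ J ↔ ∀ F, A.IsPrimeFilter F → x ∈ F → (F ∩ J).Nonempty := by
  refine ⟨fun h F _ hxF => ⟨x, hxF, h⟩, fun h => ?_⟩
  by_contra hc
  obtain ⟨F, hF, hsub, hdisj⟩ := A.exists_isPrimeFilter (J := J)
    (isFilter_Ici hx) (A.le_top _) hJ.top_mem (fun _ _ hz hyz => hJ.up_mem hz hyz)
    -- `z ∨ w ≤ z ⊔ w`, so an ideal, being closed under `⊔`, is also closed under `∨`.
    (fun z w _ _ hzJ hwJ => hJ.up_mem (hJ.meet_mem hzJ hwJ)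
      (A.vee_le (A.le_join_left z w) (A.le_join_right z w)))
    (Set.disjoint_left.2 fun z hz hzJ => hc (hJ.up_mem hzJ hz))
  exact Set.not_nonempty_iff_eq_empty.2 (Set.disjoint_iff_inter_eq_empty.1 hdisj)
    (h F hF (hsub (A.refl x)))

theorem mem_filter_iff (hF : A.IsPrimeFilter F) {x : D} (hx : A.dual.Idem x) :
    x ∈ F ↔ ∀ J, A.dual.IsPrimeFilter J → x ∈ J → (F ∩ J).Nonempty := by
  simpa only [Set.inter_comm] using mem_ideal_iff (A := A.dual) hF hx

end ModalDBA

namespace MPDBL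

-- Soundness

section Soundness

variable {K : KripkeContext.{u, v}} (V : Model K)

theorem Model.satHyper_append {B C : Hypersequent} :
    V.SatHyper (B ++ C) ↔ V.SatHyper B ∨ V.SatHyper C := by
  simp only [SatHyper, List.mem_append, or_and_right, exists_or]

theorem Model.satHyper_singleton {s : Sequent} : V.SatHyper [s] ↔ V.SatSequent s := by
  simp [SatHyper]

theorem Model.satHyper_cons {s : Sequent} {B : Hypersequent} :
    V.SatHyper (s :: B) ↔ V.SatSequent s ∨ V.SatHyper B := by
  simp [SatHyper]

theorem Model.ov_intent (n : ℕ) (m : K.M) :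
    m ∈ (V.ov n).intent ↔ ∀ g ∈ (V.ov n).extent, K.I g m := by
  conv_lhs => rw [← V.ov_left n]
  simp [Semiconcept.meet, mem_upperPolar_iff]

theorem Model.pv_extent (n : ℕ) (g : K.G) :
    g ∈ (V.pv n).extent ↔ ∀ m ∈ (V.pv n).intent, K.I g m := by
  conv_lhs => rw [← V.pv_right n]
  simp [Semiconcept.join, mem_lowerPolar_iff]

/-- Every formula is interpreted by a left or by a right semiconcept. -/
theorem Model.left_or_right (α : Formula) :
    (∀ m, V.CoSat α m ↔ ∀ g, V.Sat α g → K.I g m) ∨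
      (∀ g, V.Sat α g ↔ ∀ m, V.CoSat α m → K.I g m) := by
  cases α <;> simp [Model.Sat, Model.CoSat]
  case ov n => exact Or.inl (V.ov_intent n)
  case pv n => exact Or.inr (V.pv_extent n)

theorem Model.incident {α : Formula} {g : K.G} {m : K.M} (hg : V.Sat α g) (hm : V.CoSat α m) :
    K.I g m :=
  (V.left_or_right α).elim (fun h => (h m).1 hm g hg) fun h => (h g).1 hg m hm

theorem Model.satSequent_of_isAxiom {s : Sequent} (hs : IsAxiom s) : V.SatSequent s := by
  have inc := fun (α : Formula) g m => V.incident (α := α) (g := g) (m := m)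
  have ho := V.ov_intent
  have hp := V.pv_extent
  cases hs
  -- The two sides are `(v₂', v₂'')` and `(v₁'', v₁')`; they agree because one of `v₁`, `v₂` is the
  -- polar of the other.
  case ax14_l α | ax14_r α =>
    have := V.left_or_right α
    simp only [SatSequent, Sat, CoSat]
    grind
  all_goals
    simp only [SatSequent, Sat, CoSat, Formula.vee, Formula.wedge]
    grind

theorem Model.satSequent_of_mem {s : Sequent} (hK : K ∈ KCRST.{u, v}) (hs : s ∈ MPDBL5) :
    V.SatSequent s := by
  obtain ⟨⟨⟨hR⟩, ⟨hS⟩⟩, ⟨⟨hR'⟩, ⟨hS'⟩⟩, ⟨⟨hR''⟩, ⟨hS''⟩⟩⟩ := hK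
  have inc := fun (α : Formula) g m => V.incident (α := α) (g := g) (m := m)
  obtain (hs | ⟨α, rfl⟩) | ⟨α, rfl⟩ := hs
  · cases hs <;> simp only [SatSequent, Sat, CoSat]
    case ax19a α => exact ⟨fun g h => h g (hR g), fun m hm g hg => inc α g m (hg g (hR g)) hm⟩
    case ax19b α => exact ⟨fun g hg m hm => inc α g m hg (hm m (hS m)), fun m h => h m (hS m)⟩
    all_goals grind
  · simp only [SatSequent, Sat, CoSat, Formula.dia]
    grind
  · simp only [SatSequent, Sat, CoSat, Formula.bdia]
    grind

theorem soundness {H : Hypersequent} (h : Provable MPDBL5 H) : Valid KCRST.{u, v} H := by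
  intro K hK V
  induction h with
  | ax hs => exact V.satHyper_singleton.2 (V.satSequent_of_isAxiom hs)
  | extra hs => exact V.satHyper_singleton.2 (V.satSequent_of_mem hK hs)
  | sp α =>
    rw [V.satHyper_cons, V.satHyper_singleton]
    -- A left semiconcept satisfies the first component, a right one the second.
    have := V.left_or_right α
    simp only [Model.SatSequent, Model.Sat, Model.CoSat]
    grind
  | r4 _ _ h k =>
    simp only [V.satHyper_append, V.satHyper_singleton, Model.SatSequent] at h k ⊢
    grind
  | r5 _ _ _ _ h₁ h₂ h₃ h₄ =>
    simp only [V.satHyper_append, V.satHyper_singleton] at h₁ h₂ h₃ h₄ ⊢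
    -- The first premise here carries the inclusion of the `v₁`, the second that of the `v₂`.
    have key : ∀ {α β}, V.SatSequent (α ⊓ₗ α ⊢ₗ α ⊓ₗ β) → V.SatSequent (α ⊔ₗ β ⊢ₗ β ⊔ₗ β) →
        V.SatSequent (α ⊢ₗ β) := by
      simp only [Model.SatSequent, Model.Sat, Model.CoSat]
      grind
    have := @key
    grind
  | ec _ h => simp only [V.satHyper_append] at h ⊢; tauto
  | ee _ h => simp only [V.satHyper_append] at h ⊢; tauto
  | ew C _ h => exact V.satHyper_append.2 (Or.inl h)
  -- The remaining rules replace one component, so it suffices that the new sequent follows from the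
  -- old one in the model.
  | _ =>
    rename_i h
    simp only [V.satHyper_append, V.satHyper_singleton] at h ⊢
    refine h.imp_left (Or.imp_right ?_)
    simp only [Model.SatSequent, Model.Sat, Model.CoSat]
    grind

end Soundness

-- The Lindenbaum–Tarski algebra

section Algebra

variable {Sig : Set Sequent} {α α' β β' γ : Formula}

theorem prov_trans (h : Provable Sig [α ⊢ₗ β]) (k : Provable Sig [β ⊢ₗ γ]) :
    Provable Sig [α ⊢ₗ γ] :=
  Provable.r4 (B := []) (C := []) (D := []) (E := []) h k

theorem prov_meet (h : Provable Sig [α ⊢ₗ α']) (k : Provable Sig [β ⊢ₗ β']) :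
    Provable Sig [α ⊓ₗ β ⊢ₗ α' ⊓ₗ β'] :=
  prov_trans (.r1 (B := []) (C := []) β h) (.r1' (B := []) (C := []) α' k)

theorem prov_join (h : Provable Sig [α ⊢ₗ α']) (k : Provable Sig [β ⊢ₗ β']) :
    Provable Sig [α ⊔ₗ β ⊢ₗ α' ⊔ₗ β'] :=
  prov_trans (.r2 (B := []) (C := []) β h) (.r2' (B := []) (C := []) α' k)

theorem prov_meet_left (α β) : Provable Sig [α ⊓ₗ β ⊢ₗ α ⊓ₗ α] :=
  prov_trans (.ax (.ax4a α β)) (prov_meet (.ax (.ax2a α β)) (.ax (.ax2a α β)))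

theorem prov_join_right (α β) : Provable Sig [β ⊔ₗ β ⊢ₗ α ⊔ₗ β] :=
  prov_trans (prov_join (.ax (.ax3b α β)) (.ax (.ax3b α β))) (.ax (.ax4b α β))

namespace LT

theorem mk_eq_mk : (mk α : LT Sig) = mk β ↔ Provable Sig [α ⊢ₗ β] ∧ Provable Sig [β ⊢ₗ α] :=
  Quotient.eq (r := ltSetoid Sig)

/-- The four sequents that make up `Le` are exactly the premises of rule `r5`. Conversely, two of
them are provable outright and the other two follow from `α ⊢ β` by monotonicity. -/
theorem mk_le_mk : Le (mk α : LT Sig) (mk β) ↔ Provable Sig [α ⊢ₗ β] := by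
  change (mk (α ⊓ₗ β) : LT Sig) = mk (α ⊓ₗ α) ∧ (mk (α ⊔ₗ β) : LT Sig) = mk (β ⊔ₗ β) ↔ _
  rw [mk_eq_mk, mk_eq_mk]
  refine ⟨fun ⟨⟨h₁, h₂⟩, h₃, h₄⟩ => ?_, fun h => ⟨⟨prov_meet_left α β, ?_⟩, ?_, prov_join_right α β⟩⟩
  · exact Provable.r5 (B := []) (C := []) (D := []) (E := []) (F := []) (G := []) (H := [])
      (X := []) h₁ h₂ h₃ h₄
  · exact prov_meet (.ax (.ax1 α)) h
  · exact prov_join h (.ax (.ax1 β))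

theorem mk_le_mk_of_isAxiom (h : IsAxiom (α ⊢ₗ β)) : Le (mk α : LT Sig) (mk β) :=
  mk_le_mk.2 (.ax h)

theorem mk_eq_mk_of_isAxiom (h : IsAxiom (α ⊢ₗ β)) (k : IsAxiom (β ⊢ₗ α)) :
    (mk α : LT Sig) = mk β :=
  mk_eq_mk.2 ⟨.ax h, .ax k⟩

/-- The Lindenbaum–Tarski algebra of `MPDBL5`. -/
def modalDBA : ModalDBA (LT MPDBL5) where
  le := Le
  meet := meet
  join := join
  neg := neg
  opp := opp
  box := box
  bbox := bbox
  top := mk .top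
  bot := mk .bot
  refl := by rintro ⟨α⟩; exact mk_le_mk_of_isAxiom (.ax1 α)
  trans := by
    rintro ⟨α⟩ ⟨β⟩ ⟨γ⟩ h k
    exact mk_le_mk.2 (prov_trans (mk_le_mk.1 h) (mk_le_mk.1 k))
  antisymm := by
    rintro ⟨α⟩ ⟨β⟩ h k
    exact mk_eq_mk.2 ⟨mk_le_mk.1 h, mk_le_mk.1 k⟩
  le_of_le := by
    rintro ⟨α⟩ ⟨β⟩ h k
    have h : Provable MPDBL5 [α ⊓ₗ α ⊢ₗ β] := mk_le_mk.1 h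
    have k : Provable MPDBL5 [α ⊢ₗ β ⊔ₗ β] := mk_le_mk.1 k
    refine ⟨mk_eq_mk.2 ⟨prov_meet_left α β, ?_⟩, mk_eq_mk.2 ⟨?_, prov_join_right α β⟩⟩
    · exact prov_trans (.ax (.ax4a α α)) (prov_meet (.ax (.ax2a α α)) h)
    · exact prov_trans (prov_join k (.ax (.ax3b β β))) (.ax (.ax4b β β))
  bot_le := by rintro ⟨α⟩; exact mk_le_mk_of_isAxiom (.ax11a α)
  le_top := by rintro ⟨α⟩; exact mk_le_mk_of_isAxiom (.ax11b α)
  meet_le_left := by rintro ⟨α⟩ ⟨β⟩; exact mk_le_mk_of_isAxiom (.ax2a α β)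
  le_join_left := by rintro ⟨α⟩ ⟨β⟩; exact mk_le_mk_of_isAxiom (.ax2b α β)
  meet_le_right := by rintro ⟨α⟩ ⟨β⟩; exact mk_le_mk_of_isAxiom (.ax3a α β)
  le_join_right := by rintro ⟨α⟩ ⟨β⟩; exact mk_le_mk_of_isAxiom (.ax3b α β)
  meet_mono := by
    rintro ⟨α⟩ ⟨α'⟩ ⟨β⟩ ⟨β'⟩ h k
    exact mk_le_mk.2 (prov_meet (mk_le_mk.1 h) (mk_le_mk.1 k))
  join_mono := by
    rintro ⟨α⟩ ⟨α'⟩ ⟨β⟩ ⟨β'⟩ h k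
    exact mk_le_mk.2 (prov_join (mk_le_mk.1 h) (mk_le_mk.1 k))
  le_meet_meet := by rintro ⟨α⟩ ⟨β⟩; exact mk_le_mk_of_isAxiom (.ax4a α β)
  join_join_le := by rintro ⟨α⟩ ⟨β⟩; exact mk_le_mk_of_isAxiom (.ax4b α β)
  neg_anti := by
    rintro ⟨α⟩ ⟨β⟩ h
    exact mk_le_mk.2 (.r3 (B := []) (C := []) (mk_le_mk.1 h))
  opp_anti := by
    rintro ⟨α⟩ ⟨β⟩ h
    exact mk_le_mk.2 (.r3' (B := []) (C := []) (mk_le_mk.1 h))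
  neg_meet_self_le := by rintro ⟨α⟩; exact mk_le_mk_of_isAxiom (.ax5a α)
  le_opp_join_self := by rintro ⟨α⟩; exact mk_le_mk_of_isAxiom (.ax5b α)
  meet_neg_le := by rintro ⟨α⟩; exact mk_le_mk_of_isAxiom (.ax6a α)
  le_join_opp := by rintro ⟨α⟩; exact mk_le_mk_of_isAxiom (.ax6b α)
  neg_neg_meet := by rintro ⟨α⟩ ⟨β⟩; exact mk_eq_mk_of_isAxiom (.ax7a_l α β) (.ax7a_r α β)
  opp_opp_join := by rintro ⟨α⟩ ⟨β⟩; exact mk_eq_mk_of_isAxiom (.ax7b_l α β) (.ax7b_r α β)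
  meet_self_le := by rintro ⟨α⟩ ⟨β⟩; exact mk_le_mk_of_isAxiom (.ax9a α β)
  le_join_self := by rintro ⟨α⟩ ⟨β⟩; exact mk_le_mk_of_isAxiom (.ax9b α β)
  meet_vee_le := by rintro ⟨α⟩ ⟨β⟩ ⟨γ⟩; exact mk_le_mk_of_isAxiom (.ax10a_l α β γ)
  le_join_wedge := by rintro ⟨α⟩ ⟨β⟩ ⟨γ⟩; exact mk_le_mk_of_isAxiom (.ax10b_r α β γ)
  neg_bot := mk_eq_mk_of_isAxiom .ax13a_l .ax13a_r
  opp_top := mk_eq_mk_of_isAxiom .ax13b_l .ax13b_r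
  box_mono := by
    rintro ⟨α⟩ ⟨β⟩ h
    exact mk_le_mk.2 (.r8 (B := []) (C := []) (mk_le_mk.1 h))
  bbox_mono := by
    rintro ⟨α⟩ ⟨β⟩ h
    exact mk_le_mk.2 (.r9 (B := []) (C := []) (mk_le_mk.1 h))
  box_meet := by rintro ⟨α⟩ ⟨β⟩; exact mk_eq_mk_of_isAxiom (.ax16a_l α β) (.ax16a_r α β)
  bbox_join := by rintro ⟨α⟩ ⟨β⟩; exact mk_eq_mk_of_isAxiom (.ax16b_l α β) (.ax16b_r α β)
  box_neg_bot := mk_eq_mk_of_isAxiom .ax17a_l .ax17a_r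
  bbox_opp_top := mk_eq_mk_of_isAxiom .ax17b_l .ax17b_r
  box_meet_self := by rintro ⟨α⟩; exact mk_eq_mk_of_isAxiom (.ax18a_l α) (.ax18a_r α)
  bbox_join_self := by rintro ⟨α⟩; exact mk_eq_mk_of_isAxiom (.ax18b_l α) (.ax18b_r α)
  box_le := by rintro ⟨α⟩; exact mk_le_mk.2 (.extra (.inl (.inl (.ax19a α))))
  le_bbox := by rintro ⟨α⟩; exact mk_le_mk.2 (.extra (.inl (.inl (.ax19b α))))
  box_box := by
    rintro ⟨α⟩
    exact mk_eq_mk.2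
      ⟨.extra (.inl (.inl (.ax20a_l α))), .extra (.inl (.inl (.ax20a_r α)))⟩
  bbox_bbox := by
    rintro ⟨α⟩
    exact mk_eq_mk.2
      ⟨.extra (.inl (.inl (.ax20b_l α))), .extra (.inl (.inl (.ax20b_r α)))⟩
  dia_le := by rintro ⟨α⟩; exact mk_le_mk.2 (.extra (.inl (.inr ⟨α, rfl⟩)))
  le_bdia := by rintro ⟨α⟩; exact mk_le_mk.2 (.extra (.inr ⟨α, rfl⟩))

-- Symmetry of the canonical relations

/-- By upward closure, a nonempty trace forces `⊤ ∈ F`, and a proper trace forces `⊥ ∉ F`. -/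
theorem isPrimeFilter_of_mem {F : Set (LT MPDBL5)} (hF : F ∈ primeFilters MPDBL5) :
    modalDBA.IsPrimeFilter F := by
  obtain ⟨⟨hmeet, hup⟩, ⟨a, ha, _⟩, hne, hprime⟩ := hF
  refine ⟨⟨hmeet, hup⟩, hup ha (modalDBA.le_top a), fun hbot => hne ?_, fun x y hx hy => hprime x hx y hy⟩
  exact Set.inter_eq_right.2 fun x _ => hup hbot (modalDBA.bot_le x)

theorem isPrimeFilter_dual_of_mem {J : Set (LT MPDBL5)} (hJ : J ∈ primeIdeals MPDBL5) :
    modalDBA.dual.IsPrimeFilter J := by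
  obtain ⟨⟨hjoin, hdown⟩, ⟨a, ha, _⟩, hne, hprime⟩ := hJ
  refine ⟨⟨hjoin, fun _ _ h k => hdown h k⟩, hdown ha (modalDBA.bot_le a), fun htop => hne ?_,
    fun x y hx hy => hprime x hx y hy⟩
  exact Set.inter_eq_right.2 fun x _ => hdown htop (modalDBA.le_top x)

theorem canonicalR_symm : Std.Symm (canonicalR MPDBL5) :=
  ⟨fun F F₁ h => ModalDBA.rel_symm (isPrimeFilter_of_mem F.2) (isPrimeFilter_of_mem F₁.2) h⟩

theorem canonicalS_symm : Std.Symm (canonicalS MPDBL5) :=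
  ⟨fun J J₁ h =>
    ModalDBA.rel_symm (isPrimeFilter_dual_of_mem J.2) (isPrimeFilter_dual_of_mem J₁.2) h⟩

end LT

end Algebra

-- The canonical model and completeness

section Completeness

open _root_.MPDBL.LT

/-- The canonical Kripke context. -/
def canonicalContext : KripkeContext.{u, v} where
  -- The algebra lives in `Type`; lifting reaches contexts in arbitrary universes.
  G := ULift.{u} {F // modalDBA.IsPrimeFilter F}
  M := ULift.{v} {J // modalDBA.dual.IsPrimeFilter J}
  I F J := (F.down.1 ∩ J.down.1).Nonempty
  R F F₁ := modalDBA.Rel F.down.1 F₁.down.1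
  S J J₁ := modalDBA.dual.Rel J.down.1 J₁.down.1

theorem canonicalContext_mem : canonicalContext.{u, v} ∈ KCRST.{u, v} :=
  ⟨⟨⟨fun F => ModalDBA.rel_refl F.down.2⟩, ⟨fun J => ModalDBA.rel_refl J.down.2⟩⟩,
    ⟨⟨fun F F₁ => ModalDBA.rel_symm F.down.2 F₁.down.2⟩,
      ⟨fun J J₁ => ModalDBA.rel_symm J.down.2 J₁.down.2⟩⟩,
    ⟨⟨fun F _ _ => ModalDBA.rel_trans F.down.2⟩, ⟨fun J _ _ => ModalDBA.rel_trans J.down.2⟩⟩⟩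

/-- The prime filters containing `x`. -/
def extentOf (x : LT MPDBL5) : Set canonicalContext.{u, v}.G := {F | x ∈ F.down.1}

/-- The prime ideals containing `x`. -/
def intentOf (x : LT MPDBL5) : Set canonicalContext.{u, v}.M := {J | x ∈ J.down.1}

theorem upperPolar_extentOf {x : LT MPDBL5} (hx : modalDBA.Idem x) :
    upperPolar canonicalContext.{u, v}.I (extentOf x) = intentOf x := by
  ext J
  refine Iff.trans ?_ (ModalDBA.mem_ideal_iff J.down.2 hx).symm
  exact ⟨fun h F hF hxF => h (a := ⟨F, hF⟩) hxF, fun h F hxF => h _ F.down.2 hxF⟩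

theorem lowerPolar_intentOf {x : LT MPDBL5} (hx : modalDBA.dual.Idem x) :
    lowerPolar canonicalContext.{u, v}.I (intentOf x) = extentOf x := by
  ext F
  refine Iff.trans ?_ (ModalDBA.mem_filter_iff F.down.2 hx).symm
  exact ⟨fun h J hJ hxJ => h (b := ⟨J, hJ⟩) hxJ, fun h J hxJ => h _ J.down.2 hxJ⟩

theorem idem_ov (n : ℕ) : modalDBA.Idem (mk (.ov n)) :=
  mk_eq_mk_of_isAxiom (.ax15a_l n) (.ax15a_r n)

theorem idem_pv (n : ℕ) : modalDBA.dual.Idem (mk (.pv n)) :=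
  mk_eq_mk_of_isAxiom (.ax15b_l n) (.ax15b_r n)

/-- The canonical model. -/
def canonicalModel : Model canonicalContext.{u, v} where
  ov n := ⟨extentOf (mk (.ov n)), intentOf (mk (.ov n)), .inl (upperPolar_extentOf (idem_ov n))⟩
  pv n := ⟨extentOf (mk (.pv n)), intentOf (mk (.pv n)), .inr (lowerPolar_intentOf (idem_pv n))⟩
  ov_left n := by
    ext1
    · exact Set.inter_self _
    · exact (congrArg _ (Set.inter_self _)).trans (upperPolar_extentOf (idem_ov n))
  pv_right n := by
    ext1
    · exact (congrArg _ (Set.inter_self _)).trans (lowerPolar_intentOf (idem_pv n))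
    · exact Set.inter_self _

/-- For `⊓`, `¬` and `□`, co-satisfaction is defined as the polar of satisfaction; this derives the
ideal half of the truth lemma from the filter half. -/
theorem forall_incident_iff {x : LT MPDBL5} (hx : modalDBA.Idem x)
    {p : canonicalContext.{u, v}.G → Prop} (hp : ∀ F, p F ↔ x ∈ F.down.1)
    (J : canonicalContext.{u, v}.M) : (∀ F, p F → canonicalContext.I F J) ↔ x ∈ J.down.1 := by
  simp only [hp]
  exact Set.ext_iff.1 (upperPolar_extentOf hx) J

theorem forall_incident_iff' {x : LT MPDBL5} (hx : modalDBA.dual.Idem x)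
    {p : canonicalContext.{u, v}.M → Prop} (hp : ∀ J, p J ↔ x ∈ J.down.1)
    (F : canonicalContext.{u, v}.G) : (∀ J, p J → canonicalContext.I F J) ↔ x ∈ F.down.1 := by
  simp only [hp]
  exact Set.ext_iff.1 (lowerPolar_intentOf hx) F

/-- For `⊓`, `¬`, `□` the filter half is the matching membership law of prime filters, and
idempotency transfers it to ideals; `⊔`, `⌟`, `■` are dual. -/
theorem truth_lemma (α : Formula) :
    (∀ F, canonicalModel.{u, v}.Sat α F ↔ mk α ∈ F.down.1) ∧
      ∀ J, canonicalModel.{u, v}.CoSat α J ↔ mk α ∈ J.down.1 := by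
  induction α with
  | top =>
    simp only [Model.Sat, Model.CoSat, true_iff, false_iff]
    exact ⟨fun F => F.down.2.top_mem, fun J => J.down.2.bot_notMem⟩
  | bot =>
    simp only [Model.Sat, Model.CoSat, true_iff, false_iff]
    exact ⟨fun F => F.down.2.bot_notMem, fun J => J.down.2.top_mem⟩
  | ov n => simp only [Model.Sat, Model.CoSat]; exact ⟨fun _ => Iff.rfl, fun _ => Iff.rfl⟩
  | pv n => simp only [Model.Sat, Model.CoSat]; exact ⟨fun _ => Iff.rfl, fun _ => Iff.rfl⟩
  | meet α β ihα ihβ =>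
    simp only [Model.Sat, Model.CoSat]
    have h : ∀ F : canonicalContext.{u, v}.G,
        canonicalModel.Sat α F ∧ canonicalModel.Sat β F ↔ mk (α ⊓ₗ β) ∈ F.down.1 := fun F => by
      rw [ihα.1, ihβ.1]
      exact F.down.2.meet_mem_iff.symm
    exact ⟨h, forall_incident_iff (modalDBA.idem_meet (mk α) (mk β)) h⟩
  | join α β ihα ihβ =>
    simp only [Model.Sat, Model.CoSat]
    have h : ∀ J : canonicalContext.{u, v}.M,
        canonicalModel.CoSat α J ∧ canonicalModel.CoSat β J ↔ mk (α ⊔ₗ β) ∈ J.down.1 := fun J => by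
      rw [ihα.2, ihβ.2]
      exact J.down.2.meet_mem_iff.symm
    exact ⟨forall_incident_iff' (modalDBA.dual.idem_meet (mk α) (mk β)) h, h⟩
  | neg α ih =>
    simp only [Model.Sat, Model.CoSat]
    have h : ∀ F : canonicalContext.{u, v}.G,
        ¬ canonicalModel.Sat α F ↔ mk ¬ₗα ∈ F.down.1 := fun F => by
      rw [ih.1]
      exact F.down.2.neg_mem_iff.symm
    exact ⟨h, forall_incident_iff (modalDBA.idem_neg (mk α)) h⟩
  | opp α ih =>
    simp only [Model.Sat, Model.CoSat]
    have h : ∀ J : canonicalContext.{u, v}.M,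
        ¬ canonicalModel.CoSat α J ↔ mk ⌟ₗα ∈ J.down.1 := fun J => by
      rw [ih.2]
      exact J.down.2.neg_mem_iff.symm
    exact ⟨forall_incident_iff' (modalDBA.dual.idem_neg (mk α)) h, h⟩
  | box α ih =>
    simp only [Model.Sat, Model.CoSat]
    have h : ∀ F : canonicalContext.{u, v}.G,
        (∀ F₁, canonicalContext.R F F₁ → canonicalModel.Sat α F₁) ↔ mk □ₗα ∈ F.down.1 := fun F => by
      simp only [ih.1]
      refine Iff.trans ?_ (ModalDBA.box_mem_iff F.down.2 (x := mk α)).symm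
      exact ⟨fun h F₁ hF₁ hR => h ⟨F₁, hF₁⟩ hR, fun h F₁ hR => h _ F₁.down.2 hR⟩
    exact ⟨h, forall_incident_iff (modalDBA.idem_box (mk α)) h⟩
  | bbox α ih =>
    simp only [Model.Sat, Model.CoSat]
    have h : ∀ J : canonicalContext.{u, v}.M,
        (∀ J₁, canonicalContext.S J J₁ → canonicalModel.CoSat α J₁) ↔ mk ■ₗα ∈ J.down.1 := fun J => by
      simp only [ih.2]
      refine Iff.trans ?_ (ModalDBA.box_mem_iff J.down.2 (x := mk α)).symm
      exact ⟨fun h J₁ hJ₁ hR => h ⟨J₁, hJ₁⟩ hR, fun h J₁ hR => h _ J₁.down.2 hR⟩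
    exact ⟨forall_incident_iff' (modalDBA.dual.idem_box (mk α)) h, h⟩

theorem provable_of_satSequent {s : Sequent} (h : canonicalModel.{u, v}.SatSequent s) :
    Provable MPDBL5 [s] := by
  simp only [Model.SatSequent, (truth_lemma _).1, (truth_lemma _).2] at h
  exact mk_le_mk.1 (modalDBA.le_of_forall (fun F hF => h.1 ⟨F, hF⟩) fun J hJ => h.2 ⟨J, hJ⟩)

theorem Provable.of_mem {Sig : Set Sequent} {s : Sequent} {H : Hypersequent} (hs : s ∈ H)
    (h : Provable Sig [s]) : Provable Sig H := by
  obtain ⟨B, C, rfl⟩ := List.append_of_mem hs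
  -- Weakening adds components only on the right; exchange then moves `B` in front of `s`.
  have := Provable.ee (B := []) (D := [s]) (E := B) (C := C) (by simpa using h.ew (B ++ C))
  simpa using this

/-- One model suffices: whichever component the canonical model satisfies is already provable by
itself. -/
theorem completeness {H : Hypersequent} (h : Valid KCRST.{u, v} H) : Provable MPDBL5 H := by
  obtain ⟨s, hs, hsat⟩ := h _ canonicalContext_mem canonicalModel
  exact (provable_of_satSequent hsat).of_mem hs

end Completeness

end MPDBL

theorem mainTheorem6 :
    (∀ H : MPDBL.Hypersequent,
      MPDBL.Provable MPDBL.MPDBL5 H → MPDBL.Valid MPDBL.KCRST.{u, v} H) ∧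
    (∀ H : MPDBL.Hypersequent,
      MPDBL.Valid MPDBL.KCRST.{u, v} H → MPDBL.Provable MPDBL.MPDBL5 H) ∧
    Std.Symm (MPDBL.LT.canonicalR MPDBL.MPDBL5) ∧
    Std.Symm (MPDBL.LT.canonicalS MPDBL.MPDBL5) :=
  ⟨fun _ => MPDBL.soundness, fun _ => MPDBL.completeness, MPDBL.LT.canonicalR_symm,
    MPDBL.LT.canonicalS_symm⟩
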